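/- Consider $N$ users. User $n$ has a channel which is a $K$-state Markov chain with transition matrix $P_n$ and steady-state (stationary) probabilities $p^s_{n,1},\dots,p^s_{n,K}$. The belief states of the user are $\vec\pi_{n,j}^\tau=\vec e_jP_n^\tau$, $j\in\{1,\dots,K\}$, $\tau\in\{1,2,\dots\}$, identified with the pairs $(j,\tau)$ (the user was last selected $\tau$ slots ago and was then observed in channel state $j$). In the approximated single-user problem with subsidy $W\in\mathbb R$, in each slot one chooses between - the passive action, which in $\vec\pi_{n,j}^\tau$ earns $R_n(\vec\pi_{n,j}^\tau,0)+W$ and leads to $\vec\pi_{n,j}^{\tau+1}$, and - the active action, which earns $R_n^1$ and leads to $\vec\pi_{n,k}^1$ with probability $p^s_{n,k}$, $k=1,\dots,K$. A policy (possibly randomized and history-dependent) is optimal for $W$ if, from every initial belief state, it maximizes $\liminf_{T\to\infty}\frac1T\mathbb E(\text{total reward in the first } T \text{ slots})$ among all policies. For $\vec\Gamma\in(\{0,1,2,\dots\}\cup\{\infty\})^K$ the threshold policy $\vec\Gamma$ is passive in the belief states of $\mathcal L_{\vec\Gamma}=\{\vec\pi_{n,j}^\tau:\tau\le\Gamma_j\}$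 and active in all others. Assume that for every user $R_n^1\ge R_n(\vec\pi_{n,j}^\tau,0)\ge R_n(\vec\pi_{n,j}^{\tau'},0)$ for all $j$ and all $\tau\le\tau'$. Then every user is indexable, in the following sense. 1. For every $W$ there is an optimal threshold policy $\vec\Gamma(W)$, and these can be chosen such that $\mathcal L_{\vec\Gamma(W)}\subseteq\mathcal L_{\vec\Gamma(W')}$ for all $W<W'$. 2. If $W<W'$, every belief state in which some threshold policy that is optimal for $W$ is passive is also one in which some threshold policy that is optimal for $W'$ is passive. 3. If $W<W'$, $\vec\Gamma$ is any threshold policy that is optimal for $W$, and $\vec\Gamma'$ is any threshold policy with finite thresholds that is optimal for $W'$, then $\Gamma_j\le\Gamma'_j$ for every $j$ with $p^s_{n,j}>0$, i.e. every $\vec\pi_{n,j}^\tau\in\mathcal L_{\vec\Gamma}$ with $p^s_{n,j}>0$ lies in $\mathcal L_{\vec\Gamma'}$. -/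

import Mathlib

namespace PilotAllocation

/-- A label `(j, τ)`, `τ ≥ 1`: it stands for the belief state `π_j^τ = e_j P^τ`, in which the user
was last selected `τ` slots ago and was then observed in channel state `j`. -/
abbrev BeliefState (K : ℕ) := Fin K × ℕ+

/-- A user (arm) with a `K`-state Markov channel. -/
structure User (K : ℕ) where
  /-- transition matrix of the channel -/
  P : Matrix (Fin K) (Fin K) ℝ
  P_stochastic : P ∈ Matrix.rowStochastic ℝ (Fin K)
  /-- steady-state probabilities `p_j^s` of the channel -/
  steady : Fin K → ℝ
  steady_mem : steady ∈ stdSimplex ℝ (Fin K)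
  steady_stationary : Matrix.vecMul steady P = steady
  /-- average immediate reward `R^1` under the active action -/
  activeReward : ℝ
  /-- average immediate reward `R(π_j^τ, 0)` under the passive action -/
  passiveReward : BeliefState K → ℝ

/-- A (history-dependent, randomized) policy for one user: from the past (most recent slot first;
belief states with the actions taken there, `true` = active) and the current belief state, it gives
the probability of taking the active action. -/
abbrev Policy (K : ℕ) := List (BeliefState K × Bool) → BeliefState K → unitInterval

/-- Vectors of thresholds, the value `⊤` (never active) being allowed. -/
abbrev Thresholds (K : ℕ) := Fin K → ℕ∞

/-- The belief states in which the threshold policy `Γ` prescribes the passive action. -/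
def passiveSet {K : ℕ} (Γ : Thresholds K) : Set (BeliefState K) :=
  {s | ((s.2 : ℕ) : ℕ∞) ≤ Γ s.1}

open Classical in
/-- The threshold policy `Γ`: passive in `π_j^τ` if `τ ≤ Γ_j`, active if `τ > Γ_j`. -/
noncomputable def thresholdPolicy {K : ℕ} (Γ : Thresholds K) : Policy K :=
  fun _ s => if s ∈ passiveSet Γ then 0 else 1

namespace User

variable {K : ℕ} (u : User K)

/-- The active reward dominates the passive one, which does not increase with the age `τ`. -/
def RewardAssumption : Prop :=
  (∀ s, u.passiveReward s ≤ u.activeReward) ∧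
    ∀ (j : Fin K) (τ τ' : ℕ+), τ ≤ τ' → u.passiveReward (j, τ') ≤ u.passiveReward (j, τ)

/-- Immediate reward with subsidy `W` for passivity. -/
def reward (W : ℝ) (s : BeliefState K) : Bool → ℝ
  | false => u.passiveReward s + W
  | true => u.activeReward

/-- Transition probabilities of the approximation: passive leads from `π_i^τ` to `π_i^(τ+1)`,
active leads to `π_j^1` with the steady-state probability `p_j^s`. -/
def transition : Bool → BeliefState K → BeliefState K → ℝ
  | false, s, s' => if s'.1 = s.1 ∧ s'.2 = s.2 + 1 then 1 else 0
  | true, _, s' => if s'.2 = 1 then u.steady s'.1 else 0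

/-- Expected total reward over the next `T` slots, given the history and the current belief state.
The sums have finitely many nonzero terms. -/
noncomputable def expectedReward (W : ℝ) (φ : Policy K) :
    ℕ → List (BeliefState K × Bool) → BeliefState K → ℝ
  | 0, _, _ => 0
  | T + 1, h, s =>
      (φ h s : ℝ) * (u.reward W s true +
        ∑' s', u.transition true s s' * expectedReward W φ T ((s, true) :: h) s') +
      (1 - (φ h s : ℝ)) * (u.reward W s false +
        ∑' s', u.transition false s s' * expectedReward W φ T ((s, false) :: h) s')

/-- Long-run expected average reward (lower limit) from the initial belief state `s`. -/
noncomputable def averageReward (W : ℝ) (φ : Policy K) (s : BeliefState K) : EReal :=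
  Filter.liminf (fun T : ℕ => ((u.expectedReward W φ T [] s / (T : ℝ) : ℝ) : EReal)) Filter.atTop

/-- `φ` maximizes the average reward with subsidy `W`, among all policies, from every initial
belief state. -/
def IsOptimal (W : ℝ) (φ : Policy K) : Prop :=
  ∀ (s : BeliefState K) (ψ : Policy K), u.averageReward W ψ s ≤ u.averageReward W φ s

/-- The belief states in which some optimal threshold policy prescribes the passive action. -/
def passiveOptimalSet (W : ℝ) : Set (BeliefState K) :=
  {s | ∃ Γ : Thresholds K, u.IsOptimal W (thresholdPolicy Γ) ∧ s ∈ passiveSet Γ}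

/-- Indexability.
* Optimal threshold policies `Γ(W)` exist for all `W` and can be chosen so that their passive sets
  increase with `W`.
* The set of belief states in which the passive action is optimal increases with `W`.
* The inclusion of the passive sets does not depend on the choice of the optimal threshold policies
  as long as the thresholds of the second one are finite (over channel states of positive
  steady-state probability; the others are never entered by an active action, so that finite
  thresholds there do not influence the average reward). -/
structure IsIndexable : Prop where
  exists_monotone : ∃ Γ : ℝ → Thresholds K,
    (∀ W, u.IsOptimal W (thresholdPolicy (Γ W))) ∧
      ∀ W W', W < W' → passiveSet (Γ W) ⊆ passiveSet (Γ W')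
  passiveOptimalSet_mono : ∀ W W', W < W' → u.passiveOptimalSet W ⊆ u.passiveOptimalSet W'
  passiveSet_subset : ∀ W W', W < W' → ∀ Γ Γ' : Thresholds K,
    u.IsOptimal W (thresholdPolicy Γ) → u.IsOptimal W' (thresholdPolicy Γ') →
      (∀ j, Γ' j ≠ ⊤) → ∀ s ∈ passiveSet Γ, 0 < u.steady s.1 → s ∈ passiveSet Γ'

end User

end PilotAllocation

/-!
The approximated problem is a renewal problem: an active action forgets the state and starts a
cycle, in which the user waits passively for some time and then becomes active again. For a value
`x`, waiting in channel state `k` gains at most `∑ i, max (rho k i - x) 0` relative to the rate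
`x + W`, where `rho k i` is the passive reward. If the expectation of this gain is at most
`x + W - R¹`, where `R¹` is the active reward, then `x` is called dominating, and an induction on
the horizon (`expectedReward_le`) shows that no policy earns more than `x + W` per slot, unless
there is something to be gained from staying passive forever in the initial channel state.

The least dominating value `cutoff W` is antitone in `W`, because the set of dominating values
grows with `W`. The threshold policy that is passive exactly where `rho` is at least `cutoff W` is
optimal (`isOptimal_cutoffThreshold`). Either it stays passive forever in some channel state which
active actions reach, and earns the cutoff plus `W` there, or minimality of the cutoff forces
equality in the optimality equation (`cutoff_add_le`). This gives the monotone choice.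

Conversely, let a threshold policy be optimal for `W`. An infinite threshold requires `rho` to stay
above the cutoff (`IsOptimal.cutoff_le_rho_of_top`). If all thresholds in channel states of positive
steady-state probability are finite, then they separate the values of `rho` above the cutoff from
those below it, and the optimality equation holds with equality (`IsOptimal.cutoff_add_le_cycle`,
`IsOptimal.sum_eq`). Since a fixed value can satisfy this equation for one subsidy only, the cutoff
at such a `W` is strictly smaller than at all lower subsidies (`IsOptimal.cutoff_lt`), which gives
the inclusion for arbitrary optimal policies. For the set of belief states where passivity is
optimal, it remains to treat belief states with `rho` below the cutoff; there passivity is optimal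
only for reasons that persist when `W` grows (`passiveOptimalSet_subset`).
-/

namespace PilotAllocation

open Filter Topology

namespace User

variable {K : ℕ} (u : User K)

/-! ### Rewards over a finite horizon -/

/-- The belief state `π_j^(n+1)`: ages are counted from `0`. -/
def state (j : Fin K) (n : ℕ) : BeliefState K := (j, n.succPNat)

/-- The passive reward (without subsidy) in channel state `j` as a function of the age, counted
from `0`. -/
def rho (j : Fin K) (n : ℕ) : ℝ := u.passiveReward (state j n)

lemma exists_eq_state (s : BeliefState K) : ∃ j n, s = state j n :=
  ⟨s.1, s.2.natPred, by simp [state]⟩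

lemma state_mem_passiveSet {Γ : Thresholds K} {j : Fin K} {n : ℕ} :
    state j n ∈ passiveSet Γ ↔ (n : ℕ∞) < Γ j := by
  change (((n.succPNat : ℕ+) : ℕ) : ℕ∞) ≤ Γ j ↔ _
  rw [Nat.succPNat_coe, Nat.succ_eq_add_one, Nat.cast_add, Nat.cast_one]
  exact ENat.add_one_le_iff (ENat.natCast_ne_top n)

lemma steady_nonneg (k : Fin K) : 0 ≤ u.steady k := u.steady_mem.1 k

lemma sum_steady : ∑ k, u.steady k = 1 := u.steady_mem.2

lemma rho_antitone {u : User K} (hu : u.RewardAssumption) (j : Fin K) : Antitone (u.rho j) :=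
  fun _ _ h => hu.2 j _ _ (Nat.succPNat_le_succPNat.2 h)

lemma tsum_transition_false (j : Fin K) (n : ℕ) (f : BeliefState K → ℝ) :
    ∑' s', u.transition false (state j n) s' * f s' = f (state j (n + 1)) := by
  rw [tsum_eq_single (state j (n + 1))]
  · have : (n + 1).succPNat = n.succPNat + 1 := rfl
    simp [transition, state, this]
  · rintro ⟨i, τ⟩ hs
    have : ¬ (i = j ∧ τ = n.succPNat + 1) := by
      rintro ⟨rfl, rfl⟩
      exact hs rfl
    simp [transition, state, this]

lemma tsum_transition_true (s : BeliefState K) (f : BeliefState K → ℝ) :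
    ∑' s', u.transition true s s' * f s' = ∑ k, u.steady k * f (state k 0) := by
  have h1 : Nat.succPNat 0 = 1 := rfl
  rw [tsum_eq_sum (s := (Finset.univ : Finset (Fin K)) ×ˢ ({1} : Finset ℕ+))]
  · rw [Finset.sum_product]
    simp [transition, state, h1]
  · rintro ⟨i, τ⟩ hs
    have : τ ≠ 1 := fun h => hs (by simp [h])
    simp [transition, this]

lemma expectedReward_succ (W : ℝ) (φ : Policy K) (T : ℕ) (h : List (BeliefState K × Bool))
    (j : Fin K) (n : ℕ) :
    u.expectedReward W φ (T + 1) h (state j n) =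
      (φ h (state j n) : ℝ) * (u.activeReward + ∑ k, u.steady k *
        u.expectedReward W φ T ((state j n, true) :: h) (state k 0)) +
      (1 - (φ h (state j n) : ℝ)) * (u.rho j n + W +
        u.expectedReward W φ T ((state j n, false) :: h) (state j (n + 1))) := by
  rw [expectedReward, tsum_transition_false, tsum_transition_true]
  rfl

lemma expectedReward_threshold_passive (W : ℝ) {Γ : Thresholds K} (T : ℕ)
    (h : List (BeliefState K × Bool)) {j : Fin K} {n : ℕ} (hn : (n : ℕ∞) < Γ j) :
    u.expectedReward W (thresholdPolicy Γ) (T + 1) h (state j n) = u.rho j n + W +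
      u.expectedReward W (thresholdPolicy Γ) T ((state j n, false) :: h) (state j (n + 1)) := by
  rw [expectedReward_succ]
  simp [thresholdPolicy, state_mem_passiveSet, hn]

lemma expectedReward_threshold_active (W : ℝ) {Γ : Thresholds K} (T : ℕ)
    (h : List (BeliefState K × Bool)) {j : Fin K} {n : ℕ} (hn : ¬ (n : ℕ∞) < Γ j) :
    u.expectedReward W (thresholdPolicy Γ) (T + 1) h (state j n) =
      u.activeReward + ∑ k, u.steady k *
        u.expectedReward W (thresholdPolicy Γ) T ((state j n, true) :: h) (state k 0) := by
  rw [expectedReward_succ]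
  simp [thresholdPolicy, state_mem_passiveSet, hn]

lemma averageReward_le {W x C : ℝ} {φ : Policy K} {s : BeliefState K}
    (h : ∀ T : ℕ, u.expectedReward W φ T [] s ≤ T * x + C) : u.averageReward W φ s ≤ x := by
  have hlim : Tendsto (fun T : ℕ => ((x + C / (T : ℝ) : ℝ) : EReal)) atTop (𝓝 (x : EReal)) := by
    refine EReal.tendsto_coe.2 ?_
    simpa using tendsto_const_nhds.add (tendsto_const_div_atTop_nhds_zero_nat C)
  rw [averageReward, ← hlim.liminf_eq]
  refine liminf_le_liminf ?_
  filter_upwards [eventually_gt_atTop 0] with T hT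
  have hT' : (0 : ℝ) < T := by exact_mod_cast hT
  rw [EReal.coe_le_coe_iff, div_le_iff₀ hT']
  have := h T
  field_simp
  linarith

lemma le_averageReward {W x C : ℝ} {φ : Policy K} {s : BeliefState K}
    (h : ∀ T : ℕ, T * x + C ≤ u.expectedReward W φ T [] s) : x ≤ u.averageReward W φ s := by
  have hlim : Tendsto (fun T : ℕ => ((x + C / (T : ℝ) : ℝ) : EReal)) atTop (𝓝 (x : EReal)) := by
    refine EReal.tendsto_coe.2 ?_
    simpa using tendsto_const_nhds.add (tendsto_const_div_atTop_nhds_zero_nat C)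
  rw [averageReward, ← hlim.liminf_eq]
  refine liminf_le_liminf ?_
  filter_upwards [eventually_gt_atTop 0] with T hT
  have hT' : (0 : ℝ) < T := by exact_mod_cast hT
  rw [EReal.coe_le_coe_iff, le_div_iff₀ hT']
  have := h T
  field_simp
  linarith

/-! ### The cutoff -/

/-- Expected sum of the positive parts of the differences between the passive reward and `x` over
the ages `0, …, N - 1` of the channel state reached by an active action. -/
noncomputable def excess (x : ℝ) (N : ℕ) : ℝ :=
  ∑ k, u.steady k * ∑ i ∈ Finset.range N, max (u.rho k i - x) 0

/-- The values `x` for which no cycle, consisting of one active action and a passive stay of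
bounded length, earns more than `x + W` per slot on average. -/
def dominating (W : ℝ) : Set ℝ := {x | ∀ N, u.activeReward + u.excess x N ≤ x + W}

/-- The least dominating value: `cutoff W + W` is the maximal average reward from the channel states
that active actions reach, and passivity is worthwhile where the passive reward is at least
`cutoff W`. -/
noncomputable def cutoff (W : ℝ) : ℝ := sInf (u.dominating W)

lemma excess_mono (x : ℝ) : Monotone (u.excess x) := by
  intro M N h
  refine Finset.sum_le_sum fun k _ => mul_le_mul_of_nonneg_left ?_ (u.steady_nonneg k)
  exact Finset.sum_le_sum_of_subset_of_nonneg (Finset.range_mono h) fun _ _ _ => le_max_right _ _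

lemma excess_antitone (N : ℕ) : Antitone fun x => u.excess x N := by
  intro x y h
  refine Finset.sum_le_sum fun k _ => mul_le_mul_of_nonneg_left ?_ (u.steady_nonneg k)
  exact Finset.sum_le_sum fun i _ => max_le_max (by linarith) le_rfl

lemma continuous_excess (N : ℕ) : Continuous fun x => u.excess x N := by
  unfold excess
  fun_prop

lemma dominating_upward {W x y : ℝ} (hx : x ∈ u.dominating W) (h : x ≤ y) :
    y ∈ u.dominating W := fun N => by
  have h1 := u.excess_antitone N h
  have h2 := hx N
  dsimp only at h1
  linarith

lemma bddBelow_dominating (W : ℝ) : BddBelow (u.dominating W) := by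
  refine ⟨u.activeReward - W, fun x hx => ?_⟩
  have := hx 0
  simp only [excess, Finset.range_zero, Finset.sum_empty, mul_zero, Finset.sum_const_zero] at this
  linarith

variable {u}

lemma dominating_nonempty (hu : u.RewardAssumption) (W : ℝ) : (u.dominating W).Nonempty := by
  refine ⟨max u.activeReward (u.activeReward - W), fun N => ?_⟩
  have : u.excess (max u.activeReward (u.activeReward - W)) N = 0 := by
    refine Finset.sum_eq_zero fun k _ => mul_eq_zero_of_right _ (Finset.sum_eq_zero fun i _ => ?_)
    refine max_eq_right ?_
    have h1 : u.rho k i ≤ u.activeReward := hu.1 _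
    have h2 := le_max_left u.activeReward (u.activeReward - W)
    linarith
  have h2 := le_max_right u.activeReward (u.activeReward - W)
  linarith

lemma cutoff_mem (hu : u.RewardAssumption) (W : ℝ) : u.cutoff W ∈ u.dominating W := by
  have hc : IsClosed (u.dominating W) := by
    rw [dominating, Set.ofPred_forall]
    refine isClosed_iInter fun N => isClosed_le ?_ ?_
    · exact continuous_const.add (u.continuous_excess N)
    · fun_prop
  exact hc.csInf_mem (dominating_nonempty hu W) (u.bddBelow_dominating W)

lemma cutoff_antitone (hu : u.RewardAssumption) : Antitone u.cutoff := by
  intro W W' h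
  refine csInf_le_csInf (u.bddBelow_dominating W') (dominating_nonempty hu W) fun x hx N => ?_
  have := hx N
  linarith

/-- If the passive rewards of all channel states that are entered by active actions drop below the
cutoff, then the optimality equation holds there with equality. -/
lemma cutoff_add_le (hu : u.RewardAssumption) (W : ℝ) {N : ℕ}
    (hN : ∀ k, 0 < u.steady k → u.rho k N < u.cutoff W) :
    u.cutoff W + W ≤ u.activeReward + u.excess (u.cutoff W) N := by
  by_contra! hlt
  -- Otherwise a value slightly below the cutoff would be dominating, too.
  have h1 : ∀ᶠ x in 𝓝 (u.cutoff W), u.activeReward + u.excess x N < x + W :=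
    (continuous_const.add (u.continuous_excess N)).continuousAt.eventually_lt
      (by fun_prop) hlt
  have h2 : ∀ᶠ x in 𝓝 (u.cutoff W), ∀ k, 0 < u.steady k → u.rho k N < x := by
    refine eventually_all.2 fun k => ?_
    by_cases hk : 0 < u.steady k
    · filter_upwards [lt_mem_nhds (hN k hk)] with x hx _ using hx
    · exact Eventually.of_forall fun x h => absurd h hk
  obtain ⟨x, ⟨hx1, hx2⟩, hx3⟩ :=
    (((h1.and h2).filter_mono nhdsWithin_le_nhds).and self_mem_nhdsWithin : ∀ᶠ x in
      𝓝[<] (u.cutoff W), _ ∧ x ∈ Set.Iio (u.cutoff W)).exists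
  refine absurd (csInf_le (u.bddBelow_dominating W) fun M => ?_) (not_le.2 hx3)
  suffices u.excess x M ≤ u.excess x N by linarith
  rcases le_total M N with h | h
  · exact u.excess_mono x h
  refine Finset.sum_le_sum fun k _ => ?_
  rcases (u.steady_nonneg k).eq_or_lt with hk | hk
  · simp [← hk]
  refine mul_le_mul_of_nonneg_left (le_of_eq ?_) hk.le
  refine (Finset.sum_subset (Finset.range_mono h) fun i _ hi => max_eq_right ?_).symm
  have := rho_antitone hu k (not_lt.1 (by simpa using hi) : N ≤ i)
  linarith [hx2 k hk]

/-! ### Upper bound for all policies -/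

lemma exists_sum_max_le {f : ℕ → ℝ} (hf : Antitone f) {x : ℝ} {m : ℕ} (hm : f m ≤ x) :
    ∃ C, ∀ T, ∑ i ∈ Finset.range T, max (f i - x) 0 ≤ C := by
  refine ⟨∑ i ∈ Finset.range m, max (f i - x) 0, fun T => ?_⟩
  rcases le_total T m with h | h
  · exact Finset.sum_le_sum_of_subset_of_nonneg (Finset.range_mono h)
      fun _ _ _ => le_max_right _ _
  · refine (Finset.sum_subset (Finset.range_mono h) fun i _ hi => max_eq_right ?_).ge
    have := hf (not_lt.1 (by simpa using hi) : m ≤ i)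
    linarith

/-- Relative to the rate `x + W` of a dominating value `x`, a policy gains no more than the
positive parts of `rho - x` along an uninterrupted passive stay. -/
lemma expectedReward_le {W x : ℝ} (hx : x ∈ u.dominating W) (φ : Policy K) (T : ℕ) :
    ∀ (h : List (BeliefState K × Bool)) (j : Fin K) (n : ℕ),
      u.expectedReward W φ T h (state j n) ≤
        T * (x + W) + ∑ i ∈ Finset.range T, max (u.rho j (n + i) - x) 0 := by
  induction T with
  | zero => intro h j n; simp [expectedReward]
  | succ T ih =>
    intro h j n
    rw [expectedReward_succ]
    set q : ℝ := (φ h (state j n) : ℝ) with hq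
    have hq0 : 0 ≤ q := (φ h (state j n)).2.1
    have hq1 : q ≤ 1 := (φ h (state j n)).2.2
    set H := ∑ i ∈ Finset.range (T + 1), max (u.rho j (n + i) - x) 0 with hH
    have hH0 : 0 ≤ H := Finset.sum_nonneg fun i _ => le_max_right _ _
    have hactive : u.activeReward + ∑ k, u.steady k *
        u.expectedReward W φ T ((state j n, true) :: h) (state k 0) ≤
          ((T + 1 : ℕ) : ℝ) * (x + W) + H := by
      have h1 : ∑ k, u.steady k *
          u.expectedReward W φ T ((state j n, true) :: h) (state k 0) ≤
          T * (x + W) + u.excess x T := by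
        calc _ ≤ ∑ k, u.steady k * (T * (x + W) +
              ∑ i ∈ Finset.range T, max (u.rho k i - x) 0) :=
              Finset.sum_le_sum fun k _ => mul_le_mul_of_nonneg_left
                (by simpa using ih ((state j n, true) :: h) k 0) (u.steady_nonneg k)
          _ = _ := by
              simp_rw [mul_add, Finset.sum_add_distrib, ← Finset.sum_mul, u.sum_steady, excess]
              ring
      have h2 := hx T
      push_cast
      linarith
    have hpassive : u.rho j n + W +
        u.expectedReward W φ T ((state j n, false) :: h) (state j (n + 1)) ≤
          ((T + 1 : ℕ) : ℝ) * (x + W) + H := by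
      have h1 := ih ((state j n, false) :: h) j (n + 1)
      have h2 : H = ∑ i ∈ Finset.range T, max (u.rho j (n + 1 + i) - x) 0 +
          max (u.rho j n - x) 0 := by
        rw [hH, Finset.sum_range_succ']
        simp only [add_zero, add_assoc, add_comm 1]
      have h3 := le_max_left (u.rho j n - x) 0
      push_cast
      linarith
    nlinarith [mul_le_mul_of_nonneg_left hactive hq0,
      mul_le_mul_of_nonneg_left hpassive (sub_nonneg.2 hq1)]

lemma averageReward_le_of_dominating (hu : u.RewardAssumption) {W x : ℝ}
    (hx : x ∈ u.dominating W) {j : Fin K} {m : ℕ} (hm : u.rho j m ≤ x) (φ : Policy K) (n : ℕ) :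
    u.averageReward W φ (state j n) ≤ (x + W : ℝ) := by
  have hanti : Antitone fun i => u.rho j (n + i) :=
    fun _ _ h => rho_antitone hu j (Nat.add_le_add_left h n)
  obtain ⟨C, hC⟩ := exists_sum_max_le hanti (x := x) (m := m)
    ((rho_antitone hu j (Nat.le_add_left m n)).trans hm)
  exact u.averageReward_le (C := C) fun T =>
    (expectedReward_le hx φ T [] j n).trans (by linarith [hC T])

/-! ### Rewards of threshold policies -/

lemma expectedReward_threshold_top (W : ℝ) {Γ : Thresholds K} {j : Fin K} (hj : Γ j = ⊤) (T : ℕ) :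
    ∀ (h : List (BeliefState K × Bool)) (n : ℕ),
      u.expectedReward W (thresholdPolicy Γ) T h (state j n) =
        ∑ i ∈ Finset.range T, (u.rho j (n + i) + W) := by
  induction T with
  | zero => intro h n; simp [expectedReward]
  | succ T ih =>
    intro h n
    rw [expectedReward_threshold_passive _ _ _ _ (by simp [hj]), ih, Finset.sum_range_succ']
    simp only [add_zero, add_assoc, add_comm 1]
    ring

lemma le_averageReward_top {W c : ℝ} {Γ : Thresholds K} {j : Fin K} (hj : Γ j = ⊤)
    (hc : ∀ n, c ≤ u.rho j n) (n : ℕ) :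
    ((c + W : ℝ) : EReal) ≤ u.averageReward W (thresholdPolicy Γ) (state j n) := by
  refine u.le_averageReward (C := 0) fun T => ?_
  rw [expectedReward_threshold_top W hj]
  have := Finset.card_nsmul_le_sum (Finset.range T) (fun i => u.rho j (n + i) + W) (c + W)
    fun i _ => by linarith [hc (n + i)]
  rwa [Finset.card_range, nsmul_eq_mul, ← add_zero ((T : ℝ) * _)] at this

lemma averageReward_top_le (hu : u.RewardAssumption) (W : ℝ) {Γ : Thresholds K} {j : Fin K}
    (hj : Γ j = ⊤) (m : ℕ) :
    u.averageReward W (thresholdPolicy Γ) (state j 0) ≤ (u.rho j m + W : ℝ) := by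
  obtain ⟨C, hC⟩ := exists_sum_max_le (rho_antitone hu j) (le_refl (u.rho j m))
  refine u.averageReward_le (C := C) fun T => ?_
  rw [expectedReward_threshold_top W hj]
  have h1 : ∑ i ∈ Finset.range T, (u.rho j (0 + i) + W) ≤
      T * (u.rho j m + W) + ∑ i ∈ Finset.range T, max (u.rho j i - u.rho j m) 0 := by
    rw [← nsmul_eq_mul, ← Finset.card_range T, ← Finset.sum_const, Finset.card_range,
      ← Finset.sum_add_distrib]
    refine Finset.sum_le_sum fun i _ => ?_
    rw [zero_add]
    linarith [le_max_left (u.rho j i - u.rho j m) 0]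
  linarith [hC T]

/-- A bounded solution `v` of the inequality `g + v ≤ reward + expected next v` along a threshold
policy shows that the policy earns at least `g` per slot. -/
lemma le_averageReward_of_relativeValue {W g C : ℝ} {Γ : Thresholds K} {v : Fin K → ℕ → ℝ}
    (hC : ∀ j n, v j n ≤ C)
    (hpassive : ∀ j (n : ℕ), (n : ℕ∞) < Γ j → g + v j n ≤ u.rho j n + W + v j (n + 1))
    (hactive : ∀ j (n : ℕ), ¬ (n : ℕ∞) < Γ j →
      g + v j n ≤ u.activeReward + ∑ k, u.steady k * v k 0) (j : Fin K) (n : ℕ) :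
    (g : EReal) ≤ u.averageReward W (thresholdPolicy Γ) (state j n) := by
  have key : ∀ (T : ℕ) (h : List (BeliefState K × Bool)) (j : Fin K) (n : ℕ),
      T * g + (v j n - C) ≤ u.expectedReward W (thresholdPolicy Γ) T h (state j n) := by
    intro T
    induction T with
    | zero => intro h j n; simpa [expectedReward] using hC j n
    | succ T ih =>
      intro h j n
      by_cases hn : (n : ℕ∞) < Γ j
      · rw [expectedReward_threshold_passive _ _ _ _ hn]
        have h1 := ih ((state j n, false) :: h) j (n + 1)
        have h2 := hpassive j n hn
        push_cast
        linarith
      · rw [expectedReward_threshold_active _ _ _ _ hn]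
        have h1 : T * g + (∑ k, u.steady k * v k 0 - C) ≤ ∑ k, u.steady k *
            u.expectedReward W (thresholdPolicy Γ) T ((state j n, true) :: h) (state k 0) := by
          calc _ = ∑ k, u.steady k * (T * g + (v k 0 - C)) := by
                simp_rw [mul_add, mul_sub, Finset.sum_add_distrib, Finset.sum_sub_distrib,
                  ← Finset.sum_mul, u.sum_steady, one_mul]
            _ ≤ _ := Finset.sum_le_sum fun k _ => mul_le_mul_of_nonneg_left
                (ih _ k 0) (u.steady_nonneg k)
        have h2 := hactive j n hn
        push_cast
        linarith
  exact u.le_averageReward fun T => key T [] j n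

/-- The upper counterpart of `le_averageReward_of_relativeValue`, where the inequalities are only
needed in the channel states that are entered by active actions. -/
lemma averageReward_le_of_relativeValue {W g C : ℝ} {Γ : Thresholds K} {v : Fin K → ℕ → ℝ}
    (hC : ∀ j n, C ≤ v j n)
    (hpassive : ∀ j (n : ℕ), 0 < u.steady j → (n : ℕ∞) < Γ j →
      u.rho j n + W + v j (n + 1) ≤ g + v j n)
    (hactive : ∀ j (n : ℕ), 0 < u.steady j → ¬ (n : ℕ∞) < Γ j →
      u.activeReward + ∑ k, u.steady k * v k 0 ≤ g + v j n) {j : Fin K} (hj : 0 < u.steady j)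
    (n : ℕ) : u.averageReward W (thresholdPolicy Γ) (state j n) ≤ g := by
  have key : ∀ (T : ℕ) (h : List (BeliefState K × Bool)) (j : Fin K) (n : ℕ), 0 < u.steady j →
      u.expectedReward W (thresholdPolicy Γ) T h (state j n) ≤ T * g + (v j n - C) := by
    intro T
    induction T with
    | zero => intro h j n hj; simpa [expectedReward] using hC j n
    | succ T ih =>
      intro h j n hj
      by_cases hn : (n : ℕ∞) < Γ j
      · rw [expectedReward_threshold_passive _ _ _ _ hn]
        have h1 := ih ((state j n, false) :: h) j (n + 1) hj
        have h2 := hpassive j n hj hn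
        push_cast
        linarith
      · rw [expectedReward_threshold_active _ _ _ _ hn]
        have h1 : ∑ k, u.steady k *
            u.expectedReward W (thresholdPolicy Γ) T ((state j n, true) :: h) (state k 0) ≤
              T * g + (∑ k, u.steady k * v k 0 - C) := by
          calc _ ≤ ∑ k, u.steady k * (T * g + (v k 0 - C)) := by
                refine Finset.sum_le_sum fun k _ => ?_
                rcases (u.steady_nonneg k).eq_or_lt with hk | hk
                · simp [← hk]
                · exact mul_le_mul_of_nonneg_left (ih _ k 0 hk) hk.le
            _ = _ := by
                simp_rw [mul_add, mul_sub, Finset.sum_add_distrib, Finset.sum_sub_distrib,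
                  ← Finset.sum_mul, u.sum_steady, one_mul]
        have h2 := hactive j n hj hn
        push_cast
        linarith
  exact u.averageReward_le fun T => key T [] j n hj

variable (u) in
/-- Passive rewards minus `x`, accumulated from age `n` until the threshold of channel state `j`
is reached; the constant `A` if that threshold is infinite. -/
noncomputable def relativeValue (Γ : Thresholds K) (x A : ℝ) (j : Fin K) (n : ℕ) : ℝ :=
  if Γ j = ⊤ then A else ∑ i ∈ Finset.Ico n (Γ j).toNat, (u.rho j i - x)

lemma abs_relativeValue_le (Γ : Thresholds K) (x A : ℝ) :
    ∃ C, ∀ j n, |u.relativeValue Γ x A j n| ≤ C := by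
  refine ⟨|A| + ∑ k, ∑ i ∈ Finset.range (Γ k).toNat, |u.rho k i - x|, fun j n => ?_⟩
  have h1 : ∑ i ∈ Finset.range (Γ j).toNat, |u.rho j i - x| ≤
      ∑ k, ∑ i ∈ Finset.range (Γ k).toNat, |u.rho k i - x| :=
    Finset.single_le_sum (f := fun k => ∑ i ∈ Finset.range (Γ k).toNat, |u.rho k i - x|)
      (fun k _ => Finset.sum_nonneg fun i _ => abs_nonneg _) (Finset.mem_univ j)
  have h0 : 0 ≤ ∑ i ∈ Finset.range (Γ j).toNat, |u.rho j i - x| :=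
    Finset.sum_nonneg fun i _ => abs_nonneg _
  unfold relativeValue
  split_ifs
  · linarith
  · have h2 : ∑ i ∈ Finset.Ico n (Γ j).toNat, |u.rho j i - x| ≤
        ∑ i ∈ Finset.range (Γ j).toNat, |u.rho j i - x| :=
      Finset.sum_le_sum_of_subset_of_nonneg
        (fun i hi => Finset.mem_range.2 (Finset.mem_Ico.1 hi).2) fun _ _ _ => abs_nonneg _
    have h3 := Finset.abs_sum_le_sum_abs (fun i => u.rho j i - x) (Finset.Ico n (Γ j).toNat)
    linarith [abs_nonneg A]

lemma relativeValue_passive {Γ : Thresholds K} (x A : ℝ) {j : Fin K} {n : ℕ} (hj : Γ j ≠ ⊤)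
    (hn : (n : ℕ∞) < Γ j) :
    u.relativeValue Γ x A j n = u.rho j n - x + u.relativeValue Γ x A j (n + 1) := by
  have : n < (Γ j).toNat := by rwa [← ENat.natCast_toNat hj, Nat.cast_lt] at hn
  simp only [relativeValue, if_neg hj]
  rw [Finset.sum_eq_sum_Ico_succ_bot this]

lemma relativeValue_active {Γ : Thresholds K} (x A : ℝ) {j : Fin K} {n : ℕ}
    (hn : ¬ (n : ℕ∞) < Γ j) : u.relativeValue Γ x A j n = 0 := by
  have hj : Γ j ≠ ⊤ := fun h => hn (by simp [h])
  have : ¬ n < (Γ j).toNat := by rwa [← ENat.natCast_toNat hj, Nat.cast_lt] at hn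
  simp only [relativeValue, if_neg hj]
  rw [Finset.Ico_eq_empty this, Finset.sum_empty]

lemma relativeValue_zero {Γ : Thresholds K} (x A : ℝ) {j : Fin K} (hj : Γ j ≠ ⊤) :
    u.relativeValue Γ x A j 0 = ∑ i ∈ Finset.range (Γ j).toNat, (u.rho j i - x) := by
  simp [relativeValue, hj]

variable (u) in
/-- Expected sum of the differences between passive reward and `x` over the passive stay that
follows an active action. Channel states with infinite threshold contribute `0` and matter only if
their steady-state probability is positive. -/
noncomputable def cycleValue (Γ : Thresholds K) (x : ℝ) : ℝ :=
  ∑ k, u.steady k * ∑ i ∈ Finset.range (Γ k).toNat, (u.rho k i - x)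

/-- A threshold policy earns at least `x + W` per slot if infinite thresholds are used only where
the passive reward stays above `x`, and if either there is such a channel state which active
actions reach, or a cycle between active actions earns at least `x + W` per slot. -/
lemma le_averageReward_threshold {W x : ℝ} {Γ : Thresholds K}
    (htop : ∀ k, Γ k = ⊤ → ∀ n, x ≤ u.rho k n)
    (hcycle : (∃ l, 0 < u.steady l ∧ Γ l = ⊤) ∨
      (∀ k, 0 < u.steady k → Γ k ≠ ⊤) ∧ x + W ≤ u.activeReward + u.cycleValue Γ x)
    (j : Fin K) (n : ℕ) :
    ((x + W : ℝ) : EReal) ≤ u.averageReward W (thresholdPolicy Γ) (state j n) := by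
  obtain ⟨A, hA⟩ : ∃ A : ℝ,
      x + W ≤ u.activeReward + ∑ k, u.steady k * u.relativeValue Γ x A k 0 := by
    rcases hcycle with ⟨l, hl, hlt⟩ | ⟨hfin, hc⟩
    · -- With probability at least `u.steady l` an active action ends in the absorbing state `l`.
      -- Arriving there can be credited with an arbitrarily large amount.
      have hA0 : ∀ A : ℝ, 0 ≤ A → u.steady l * A + u.cycleValue Γ x -
          ∑ k, u.steady k * |∑ i ∈ Finset.range (Γ k).toNat, (u.rho k i - x)| ≤
          ∑ k, u.steady k * u.relativeValue Γ x A k 0 := by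
        intro A hA
        have h1 : u.steady l * A ≤ ∑ k, u.steady k * (if Γ k = ⊤ then A else 0) := by
          have := Finset.single_le_sum (f := fun k => u.steady k * (if Γ k = ⊤ then A else 0))
            (fun k _ => mul_nonneg (u.steady_nonneg k) (by split_ifs <;> simp [hA]))
            (Finset.mem_univ l)
          simpa [hlt] using this
        have h2 : ∑ k, u.steady k * (if Γ k = ⊤ then A else 0) + u.cycleValue Γ x -
            ∑ k, u.steady k * |∑ i ∈ Finset.range (Γ k).toNat, (u.rho k i - x)| ≤
            ∑ k, u.steady k * u.relativeValue Γ x A k 0 := by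
          rw [cycleValue, ← Finset.sum_add_distrib, ← Finset.sum_sub_distrib]
          refine Finset.sum_le_sum fun k _ => ?_
          rw [← mul_add, ← mul_sub]
          refine mul_le_mul_of_nonneg_left ?_ (u.steady_nonneg k)
          by_cases hk : Γ k = ⊤
          · simp [relativeValue, hk]
          · rw [relativeValue_zero x A hk, if_neg hk]
            linarith [abs_nonneg (∑ i ∈ Finset.range (Γ k).toNat, (u.rho k i - x))]
        linarith
      set D := u.cycleValue Γ x -
          ∑ k, u.steady k * |∑ i ∈ Finset.range (Γ k).toNat, (u.rho k i - x)| with hD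
      refine ⟨max 0 ((x + W - u.activeReward - D) / u.steady l), ?_⟩
      have h1 := hA0 _ (le_max_left 0 ((x + W - u.activeReward - D) / u.steady l))
      have h2 := (div_le_iff₀' hl).1 (le_max_right 0 ((x + W - u.activeReward - D) / u.steady l))
      linarith
    · refine ⟨0, hc.trans (le_of_eq ?_)⟩
      rw [cycleValue]
      congr 1
      refine Finset.sum_congr rfl fun k _ => ?_
      rcases (u.steady_nonneg k).eq_or_lt with hk | hk
      · simp [← hk]
      · rw [relativeValue_zero x 0 (hfin k hk)]
  obtain ⟨C, hC⟩ := abs_relativeValue_le (u := u) Γ x A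
  refine le_averageReward_of_relativeValue (v := u.relativeValue Γ x A)
    (fun j n => (le_abs_self _).trans (hC j n)) ?_ ?_ j n
  · intro j n hn
    by_cases hj : Γ j = ⊤
    · simp only [relativeValue, if_pos hj]
      linarith [htop j hj n]
    · rw [relativeValue_passive x A hj hn]
      linarith
  · intro j n hn
    rw [relativeValue_active x A hn]
    linarith

lemma averageReward_threshold_le {W x : ℝ} {Γ : Thresholds K}
    (hfin : ∀ k, 0 < u.steady k → Γ k ≠ ⊤)
    (hc : u.activeReward + u.cycleValue Γ x ≤ x + W) {j : Fin K} (hj : 0 < u.steady j) :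
    u.averageReward W (thresholdPolicy Γ) (state j 0) ≤ (x + W : ℝ) := by
  obtain ⟨C, hC⟩ := abs_relativeValue_le (u := u) Γ x 0
  refine averageReward_le_of_relativeValue (v := u.relativeValue Γ x 0)
    (fun j n => (abs_le.1 (hC j n)).1) ?_ ?_ hj 0
  · intro j n hj hn
    rw [relativeValue_passive x 0 (hfin j hj) hn]
    linarith
  · intro j n hj hn
    rw [relativeValue_active x 0 hn, add_zero]
    refine le_trans (le_of_eq ?_) hc
    rw [cycleValue]
    congr 1
    refine Finset.sum_congr rfl fun k _ => ?_
    rcases (u.steady_nonneg k).eq_or_lt with hk | hk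
    · simp [← hk]
    · rw [relativeValue_zero x 0 (hfin k hk)]

/-! ### Optimal threshold policies -/

/-- Besides the hypotheses of `le_averageReward_threshold` for the cutoff, optimality requires that
channel states with finite threshold do not have passive rewards that stay above the cutoff. -/
lemma isOptimal_threshold (hu : u.RewardAssumption) {W : ℝ} {Γ : Thresholds K}
    (htop : ∀ k, Γ k = ⊤ → ∀ n, u.cutoff W ≤ u.rho k n)
    (hfin : ∀ k, Γ k ≠ ⊤ → ∃ n, u.rho k n ≤ u.cutoff W)
    (hcycle : (∃ l, 0 < u.steady l ∧ Γ l = ⊤) ∨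
      (∀ k, 0 < u.steady k → Γ k ≠ ⊤) ∧
        u.cutoff W + W ≤ u.activeReward + u.cycleValue Γ (u.cutoff W)) :
    u.IsOptimal W (thresholdPolicy Γ) := by
  intro s ψ
  obtain ⟨j, n, rfl⟩ := exists_eq_state s
  by_cases hj : Γ j = ⊤
  · have hbdd : BddBelow (Set.range (u.rho j)) := ⟨u.cutoff W, by
      rintro _ ⟨n, rfl⟩
      exact htop j hj n⟩
    refine le_trans ?_ (le_averageReward_top (c := ⨅ n, u.rho j n) hj (ciInf_le hbdd) n)
    refine EReal.le_of_forall_lt_iff_le.1 fun z hz => ?_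
    have hz' : (⨅ n, u.rho j n) < z - W := by
      have := EReal.coe_lt_coe_iff.1 hz
      linarith
    obtain ⟨m, hm⟩ := exists_lt_of_ciInf_lt hz'
    have hc : u.cutoff W ≤ z - W := (le_ciInf (htop j hj)).trans hz'.le
    simpa using averageReward_le_of_dominating hu (u.dominating_upward (cutoff_mem hu W) hc)
      hm.le ψ n
  · obtain ⟨m, hm⟩ := hfin j hj
    exact (averageReward_le_of_dominating hu (cutoff_mem hu W) hm ψ n).trans
      (le_averageReward_threshold htop hcycle j n)

open Classical in
variable (u) in
/-- The threshold policy that is passive exactly where the passive reward is at least the cutoff: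
`Nat.find` gives the first age, counted from `0`, at which it is active. -/
noncomputable def cutoffThreshold (W : ℝ) : Thresholds K := fun j =>
  if h : ∃ n, u.rho j n < u.cutoff W then ((Nat.find h : ℕ) : ℕ∞) else ⊤

lemma cutoffThreshold_eq_top {W : ℝ} {j : Fin K} :
    u.cutoffThreshold W j = ⊤ ↔ ∀ n, u.cutoff W ≤ u.rho j n := by
  unfold cutoffThreshold
  split_ifs with h
  · simpa using h
  · simpa using h

lemma lt_cutoffThreshold (hu : u.RewardAssumption) {W : ℝ} {j : Fin K} {n : ℕ} :
    (n : ℕ∞) < u.cutoffThreshold W j ↔ u.cutoff W ≤ u.rho j n := by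
  unfold cutoffThreshold
  split_ifs with h
  · rw [Nat.cast_lt, Nat.lt_find_iff]
    refine ⟨fun H => not_lt.1 (H n le_rfl), fun H m hm => not_lt.2 ?_⟩
    exact H.trans (rho_antitone hu j hm)
  · push Not at h
    simpa using h n

/-- For thresholds at which the sign of `rho - x` changes, the cycle value is the excess. -/
lemma cycleValue_eq_excess {Γ : Thresholds K} {x : ℝ} {N : ℕ}
    (hN : ∀ k, 0 < u.steady k → (Γ k).toNat ≤ N)
    (hlt : ∀ k, 0 < u.steady k → ∀ i < (Γ k).toNat, x ≤ u.rho k i)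
    (hge : ∀ k, 0 < u.steady k → ∀ i, (Γ k).toNat ≤ i → u.rho k i ≤ x) :
    u.cycleValue Γ x = u.excess x N := by
  refine Finset.sum_congr rfl fun k _ => ?_
  rcases (u.steady_nonneg k).eq_or_lt with hk | hk
  · simp [← hk]
  congr 1
  rw [← Finset.sum_subset (Finset.range_mono (hN k hk)) fun i _ hi =>
    max_eq_right (sub_nonpos.2 (hge k hk i (not_lt.1 (by simpa using hi))))]
  exact Finset.sum_congr rfl fun i hi =>
    (max_eq_left (sub_nonneg.2 (hlt k hk i (Finset.mem_range.1 hi)))).symm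

lemma exists_toNat_le (Γ : Thresholds K) : ∃ N, ∀ k, (Γ k).toNat ≤ N :=
  ⟨Finset.univ.sup fun k => (Γ k).toNat, fun k =>
    Finset.le_sup (f := fun k => (Γ k).toNat) (Finset.mem_univ k)⟩

lemma cutoffThreshold_cycle (hu : u.RewardAssumption) (W : ℝ)
    (hfin : ∀ k, 0 < u.steady k → u.cutoffThreshold W k ≠ ⊤) :
    u.cutoff W + W ≤ u.activeReward + u.cycleValue (u.cutoffThreshold W) (u.cutoff W) := by
  obtain ⟨N, hN⟩ := exists_toNat_le (u.cutoffThreshold W)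
  have hiff : ∀ k, 0 < u.steady k → ∀ i,
      i < (u.cutoffThreshold W k).toNat ↔ u.cutoff W ≤ u.rho k i := by
    intro k hk i
    rw [← lt_cutoffThreshold hu, ← Nat.cast_lt (α := ℕ∞), ENat.natCast_toNat (hfin k hk)]
  rw [cycleValue_eq_excess (fun k _ => hN k) (fun k hk i hi => (hiff k hk i).1 hi)
    (fun k hk i hi => (not_le.1 fun h => absurd ((hiff k hk i).2 h) (not_lt.2 hi)).le)]
  exact cutoff_add_le hu W fun k hk =>
    not_le.1 fun h => absurd ((hiff k hk N).2 h) (not_lt.2 (hN k))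

lemma cutoffThreshold_cycle_or (hu : u.RewardAssumption) (W : ℝ) :
    (∃ l, 0 < u.steady l ∧ u.cutoffThreshold W l = ⊤) ∨
      (∀ k, 0 < u.steady k → u.cutoffThreshold W k ≠ ⊤) ∧
        u.cutoff W + W ≤ u.activeReward + u.cycleValue (u.cutoffThreshold W) (u.cutoff W) := by
  by_cases h : ∃ l, 0 < u.steady l ∧ u.cutoffThreshold W l = ⊤
  · exact Or.inl h
  · push Not at h
    exact Or.inr ⟨h, cutoffThreshold_cycle hu W h⟩

lemma exists_rho_le_of_cutoffThreshold_ne_top {W : ℝ} {k : Fin K}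
    (hk : u.cutoffThreshold W k ≠ ⊤) : ∃ n, u.rho k n ≤ u.cutoff W := by
  rw [Ne, cutoffThreshold_eq_top] at hk
  push Not at hk
  exact hk.imp fun _ h => h.le

lemma isOptimal_cutoffThreshold (hu : u.RewardAssumption) (W : ℝ) :
    u.IsOptimal W (thresholdPolicy (u.cutoffThreshold W)) :=
  isOptimal_threshold hu (fun _ hk => cutoffThreshold_eq_top.1 hk)
    (fun _ hk => exists_rho_le_of_cutoffThreshold_ne_top hk) (cutoffThreshold_cycle_or hu W)

lemma IsOptimal.cutoff_le_averageReward (hu : u.RewardAssumption) {W : ℝ} {φ : Policy K}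
    (hφ : u.IsOptimal W φ) (j : Fin K) (n : ℕ) :
    ((u.cutoff W + W : ℝ) : EReal) ≤ u.averageReward W φ (state j n) :=
  (le_averageReward_threshold (fun _ hk => cutoffThreshold_eq_top.1 hk)
    (cutoffThreshold_cycle_or hu W) j n).trans (hφ _ _)

lemma IsOptimal.cutoff_le_rho_of_top (hu : u.RewardAssumption) {W : ℝ} {Γ : Thresholds K}
    (hΓ : u.IsOptimal W (thresholdPolicy Γ)) {l : Fin K} (hl : Γ l = ⊤) (n : ℕ) :
    u.cutoff W ≤ u.rho l n := by
  have := EReal.coe_le_coe_iff.1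
    ((hΓ.cutoff_le_averageReward hu l 0).trans (averageReward_top_le hu W hl n))
  linarith

lemma exists_steady_pos : ∃ j, 0 < u.steady j := by
  by_contra! h
  have := Finset.sum_nonpos fun k (_ : k ∈ Finset.univ) => h k
  rw [u.sum_steady] at this
  linarith

/-- For an optimal threshold policy with finite thresholds, a cycle earns at least the maximal
average reward per slot. -/
lemma IsOptimal.cutoff_add_le_cycle (hu : u.RewardAssumption) {W : ℝ} {Γ : Thresholds K}
    (hΓ : u.IsOptimal W (thresholdPolicy Γ)) (hfin : ∀ k, 0 < u.steady k → Γ k ≠ ⊤) :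
    u.cutoff W + W ≤ u.activeReward + u.cycleValue Γ (u.cutoff W) := by
  obtain ⟨j, hj⟩ := u.exists_steady_pos
  -- `L + 1` is the expected cycle length; `x + W` is the reward per slot over a cycle.
  set L : ℝ := ∑ k, u.steady k * ((Γ k).toNat : ℝ) with hL
  have hL0 : 0 ≤ L :=
    Finset.sum_nonneg fun k _ => mul_nonneg (u.steady_nonneg k) (Nat.cast_nonneg _)
  have hlin : ∀ x, u.cycleValue Γ x = u.cycleValue Γ 0 - L * x := by
    intro x
    rw [cycleValue, cycleValue, hL, Finset.sum_mul, ← Finset.sum_sub_distrib]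
    refine Finset.sum_congr rfl fun k _ => ?_
    simp [Finset.sum_sub_distrib]
    ring
  set x := (u.activeReward + u.cycleValue Γ 0 - W) / (L + 1) with hx
  have hxe : x * (L + 1) = u.activeReward + u.cycleValue Γ 0 - W :=
    div_mul_cancel₀ _ (by linarith)
  have h1 : u.cutoff W ≤ x := by
    have := EReal.coe_le_coe_iff.1 ((hΓ.cutoff_le_averageReward hu j 0).trans
      (averageReward_threshold_le (x := x) hfin (by rw [hlin]; linarith) hj))
    linarith
  rw [hlin]
  nlinarith [mul_le_mul_of_nonneg_right h1 (by linarith : 0 ≤ L + 1)]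

lemma sum_range_sub_le (k : Fin K) (x : ℝ) {m N : ℕ} (h : m ≤ N) :
    ∑ i ∈ Finset.range m, (u.rho k i - x) ≤ ∑ i ∈ Finset.range N, max (u.rho k i - x) 0 :=
  (Finset.sum_le_sum fun _ _ => le_max_left _ _).trans
    (Finset.sum_le_sum_of_subset_of_nonneg (Finset.range_mono h) fun _ _ _ => le_max_right _ _)

lemma cycleValue_le_excess {Γ : Thresholds K} (x : ℝ) {N : ℕ} (hN : ∀ k, (Γ k).toNat ≤ N) :
    u.cycleValue Γ x ≤ u.excess x N :=
  Finset.sum_le_sum fun k _ =>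
    mul_le_mul_of_nonneg_left (sum_range_sub_le k x (hN k)) (u.steady_nonneg k)

/-- In the channel states that active actions reach, the thresholds of an optimal policy separate
passive rewards above the cutoff from those below, provided they are finite. -/
lemma IsOptimal.sum_eq (hu : u.RewardAssumption) {W : ℝ} {Γ : Thresholds K}
    (hΓ : u.IsOptimal W (thresholdPolicy Γ)) (hfin : ∀ k, 0 < u.steady k → Γ k ≠ ⊤)
    {N : ℕ} (hN : ∀ k, (Γ k).toNat ≤ N) {j : Fin K} (hj : 0 < u.steady j) :
    ∑ i ∈ Finset.range (Γ j).toNat, (u.rho j i - u.cutoff W) =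
      ∑ i ∈ Finset.range N, max (u.rho j i - u.cutoff W) 0 := by
  have h1 := hΓ.cutoff_add_le_cycle hu hfin
  have h2 := cutoff_mem hu W N
  have h3 : u.cycleValue Γ (u.cutoff W) = u.excess (u.cutoff W) N :=
    le_antisymm (cycleValue_le_excess _ hN) (by linarith)
  have h4 := (Finset.sum_eq_sum_iff_of_le fun k _ => mul_le_mul_of_nonneg_left
    (sum_range_sub_le k (u.cutoff W) (hN k)) (u.steady_nonneg k)).1 h3 j (Finset.mem_univ j)
  exact mul_left_cancel₀ hj.ne' h4

lemma IsOptimal.cutoff_le_rho (hu : u.RewardAssumption) {W : ℝ} {Γ : Thresholds K}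
    (hΓ : u.IsOptimal W (thresholdPolicy Γ)) (hfin : ∀ k, 0 < u.steady k → Γ k ≠ ⊤)
    {j : Fin K} (hj : 0 < u.steady j) {n : ℕ} (hn : (n : ℕ∞) < Γ j) :
    u.cutoff W ≤ u.rho j n := by
  obtain ⟨N, hN⟩ := exists_toNat_le Γ
  have hn' : n < (Γ j).toNat := by rwa [← ENat.natCast_toNat (hfin j hj), Nat.cast_lt] at hn
  have h1 := hΓ.sum_eq hu hfin hN hj
  have h2 : ∑ i ∈ Finset.range (Γ j).toNat, (u.rho j i - u.cutoff W) =
      ∑ i ∈ Finset.range (Γ j).toNat, max (u.rho j i - u.cutoff W) 0 := by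
    refine le_antisymm (sum_range_sub_le j _ le_rfl) (h1 ▸ ?_)
    exact Finset.sum_le_sum_of_subset_of_nonneg (Finset.range_mono (hN j))
      fun _ _ _ => le_max_right _ _
  have h3 := (Finset.sum_eq_sum_iff_of_le fun i _ => le_max_left _ _).1 h2 n
    (Finset.mem_range.2 hn')
  linarith [max_eq_left_iff.1 h3.symm]

lemma IsOptimal.rho_le_cutoff (hu : u.RewardAssumption) {W : ℝ} {Γ : Thresholds K}
    (hΓ : u.IsOptimal W (thresholdPolicy Γ)) (hfin : ∀ k, 0 < u.steady k → Γ k ≠ ⊤)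
    {j : Fin K} (hj : 0 < u.steady j) {n : ℕ} (hn : ¬ (n : ℕ∞) < Γ j) :
    u.rho j n ≤ u.cutoff W := by
  obtain ⟨N, hN⟩ := exists_toNat_le Γ
  have hn' : (Γ j).toNat ≤ n := by
    rwa [← ENat.natCast_toNat (hfin j hj), Nat.cast_lt, not_lt] at hn
  have h1 := hΓ.sum_eq hu hfin (N := N + n + 1) (fun k => (hN k).trans (by omega)) hj
  have h3 : ∑ i ∈ Finset.range (n + 1), max (u.rho j i - u.cutoff W) 0 ≤
      ∑ i ∈ Finset.range (N + n + 1), max (u.rho j i - u.cutoff W) 0 :=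
    Finset.sum_le_sum_of_subset_of_nonneg (Finset.range_mono (by omega))
      fun _ _ _ => le_max_right _ _
  rw [Finset.sum_range_succ] at h3
  have h4 : ∑ i ∈ Finset.range (Γ j).toNat, (u.rho j i - u.cutoff W) ≤
      ∑ i ∈ Finset.range n, max (u.rho j i - u.cutoff W) 0 := sum_range_sub_le j _ hn'
  linarith [le_max_left (u.rho j n - u.cutoff W) 0]

/-! ### Indexability -/

/-- The cutoff at `W'` is strictly smaller than at all lower subsidies if some threshold policy with
finite thresholds is optimal for `W'`. -/
lemma IsOptimal.cutoff_lt (hu : u.RewardAssumption) {W W' : ℝ} (hW : W < W') {Γ : Thresholds K}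
    (hΓ : u.IsOptimal W' (thresholdPolicy Γ)) (hfin : ∀ k, 0 < u.steady k → Γ k ≠ ⊤) :
    u.cutoff W' < u.cutoff W := by
  refine lt_of_le_of_ne (cutoff_antitone hu hW.le) fun h => ?_
  obtain ⟨N, hN⟩ := exists_toNat_le Γ
  have h1 := hΓ.cutoff_add_le_cycle hu hfin
  have h2 := cycleValue_le_excess (u := u) (u.cutoff W') hN
  have h3 := cutoff_mem hu W N
  rw [← h] at h3
  linarith

/-- Passivity in a belief state where some optimal threshold policy for a smaller subsidy is
passive can be added to the cutoff policy without loss: either active actions never lead there, or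
the cutoff policy ends in an absorbing passive stay, and what precedes it does not matter. -/
lemma passiveOptimalSet_subset (hu : u.RewardAssumption) {W W' : ℝ} (hW : W < W') :
    u.passiveOptimalSet W ⊆ u.passiveOptimalSet W' := by
  rintro s ⟨Γ, hΓ, hs⟩
  obtain ⟨j, n, rfl⟩ := exists_eq_state s
  rw [state_mem_passiveSet] at hs
  rcases le_or_gt (u.cutoff W') (u.rho j n) with hc | hc
  · exact ⟨_, isOptimal_cutoffThreshold hu W',
      state_mem_passiveSet.2 ((lt_cutoffThreshold hu).2 hc)⟩
  have hcW : u.rho j n < u.cutoff W := hc.trans_le (cutoff_antitone hu hW.le)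
  have hj : u.cutoffThreshold W' j ≠ ⊤ := fun h => absurd (cutoffThreshold_eq_top.1 h n)
    (not_le.2 hc)
  set Γ' : Thresholds K := Function.update (u.cutoffThreshold W') j ((n + 1 : ℕ) : ℕ∞) with hΓ'
  have hΓ'j : Γ' j = ((n + 1 : ℕ) : ℕ∞) := Function.update_self ..
  have hΓ'ne : ∀ k, k ≠ j → Γ' k = u.cutoffThreshold W' k :=
    fun k hk => Function.update_of_ne hk ..
  have hΓ'top : ∀ k, Γ' k = ⊤ ↔ u.cutoffThreshold W' k = ⊤ := by
    intro k
    by_cases hk : k = j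
    · subst hk
      simp only [hΓ'j, hj, iff_false]
      exact ENat.natCast_ne_top _
    · rw [hΓ'ne k hk]
  refine ⟨Γ', isOptimal_threshold hu (fun k hk => cutoffThreshold_eq_top.1 ((hΓ'top k).1 hk))
    (fun k hk => exists_rho_le_of_cutoffThreshold_ne_top (mt (hΓ'top k).2 hk)) ?_, ?_⟩
  · by_cases hl : ∃ l, 0 < u.steady l ∧ Γ l = ⊤
    · obtain ⟨l, hl, hlt⟩ := hl
      refine Or.inl ⟨l, hl, (hΓ'top l).2 (cutoffThreshold_eq_top.2 fun m => ?_)⟩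
      exact (cutoff_antitone hu hW.le).trans (hΓ.cutoff_le_rho_of_top hu hlt m)
    · push Not at hl
      have hj0 : u.steady j = 0 := by
        refine le_antisymm (not_lt.1 fun h => ?_) (u.steady_nonneg j)
        exact absurd (hΓ.cutoff_le_rho hu hl h hs) (not_le.2 hcW)
      have hcyc : u.cycleValue Γ' (u.cutoff W') =
          u.cycleValue (u.cutoffThreshold W') (u.cutoff W') := by
        refine Finset.sum_congr rfl fun k _ => ?_
        by_cases hk : k = j
        · subst hk
          simp [hj0]
        · rw [hΓ'ne k hk]
      simp only [Ne, hΓ'top, hcyc]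
      exact cutoffThreshold_cycle_or hu W'
  · rw [state_mem_passiveSet, hΓ'j, Nat.cast_lt]
    exact Nat.lt_succ_self n

theorem isIndexable (hu : u.RewardAssumption) : u.IsIndexable where
  exists_monotone := by
    refine ⟨u.cutoffThreshold, isOptimal_cutoffThreshold hu, fun W W' hW s hs => ?_⟩
    obtain ⟨j, n, rfl⟩ := exists_eq_state s
    rw [state_mem_passiveSet, lt_cutoffThreshold hu] at hs ⊢
    exact (cutoff_antitone hu hW.le).trans hs
  passiveOptimalSet_mono _ _ hW := passiveOptimalSet_subset hu hW
  passiveSet_subset := by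
    intro W W' hW Γ Γ' hΓ hΓ' hfin' s hs hpos
    have hlt := hΓ'.cutoff_lt hu hW fun k _ => hfin' k
    by_cases hl : ∃ l, 0 < u.steady l ∧ Γ l = ⊤
    · -- The passive reward of `l` would stay above the cutoff for `W`, but it drops to the smaller
      -- cutoff for `W'` beyond the finite threshold.
      obtain ⟨l, hl, hlt'⟩ := hl
      have h1 := hΓ.cutoff_le_rho_of_top hu hlt' (Γ' l).toNat
      have h2 := hΓ'.rho_le_cutoff hu (fun k _ => hfin' k) hl (n := (Γ' l).toNat)
        (by rw [ENat.natCast_toNat (hfin' l)]; exact lt_irrefl _)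
      linarith
    · push Not at hl
      obtain ⟨j, n, rfl⟩ := exists_eq_state s
      rw [state_mem_passiveSet] at hs ⊢
      by_contra hn
      have h1 := hΓ.cutoff_le_rho hu hl hpos hs
      have h2 := hΓ'.rho_le_cutoff hu (fun k _ => hfin' k) hpos hn
      linarith

end User

end PilotAllocation

theorem proposition1 {N K : ℕ} (user : Fin N → PilotAllocation.User K)
    (hR : ∀ n, (user n).RewardAssumption) :
    ∀ n, (user n).IsIndexable :=
  fun n => PilotAllocation.User.isIndexable (hR n)
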